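/- **Conventions.** Let $\mathbf K$ be a (strict) $2$-category. For a $2$-morphism $\eta$, write $G\eta$ and $\eta_F$ for its whiskerings by postcomposition with $G$ and precomposition with $F$. A *tangentad* $(\mathbb X,\mathbb T)$ in $\mathbf K$ is an object $\mathbb X$ with a $1$-morphism $T\colon\mathbb X\to\mathbb X$ and $2$-morphisms $p\colon T\Rightarrow\mathrm{id}$, $z\colon\mathrm{id}\Rightarrow T$, $s\colon T_2\Rightarrow T$, $l\colon T\Rightarrow T^2$, $c\colon T^2\Rightarrow T^2$ satisfying the axioms of a tangent structure (Cockett–Cruttwell) internally to $\mathbf K(\mathbb X,\mathbb X)$: all $n$-fold pullbacks $T_n$ of $p$ along itself exist, are pointwise (preserved by precomposition with every $F\colon\mathbb Y\to\mathbb X$) and preserved by all iterates $T^m$; $(p,z,s)$ is an additive bundle; $(z,l)\colon p\to Tp$ and $(\mathrm{id},c)\colon Tp\to p_T$ are additive bundle morphisms; $Tl\circ l=l_T\circ l$, $c\circ l=l$, $c_T\circ Tc\circ l_T=Tl\circ c$, $c\circ c=\mathrm{id}$, $Tc\circ c_T\circ Tc=c_T\circ Tc\circ c_T$; and the square $Tp\circ\big(Ts\circ\langle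 l\pi_1,z_T\pi_2\rangle\big)=z\circ(p\pi_1)$ is a pointwise pullback. A *lax tangent morphism* $(F,\alpha)\colon(\mathbb X,\mathbb T)\to(\mathbb X',\mathbb T')$ is a $1$-morphism $F\colon\mathbb X\to\mathbb X'$ with a $2$-morphism $\alpha\colon F\circ T\Rightarrow T'\circ F$ compatible with $p$, $z$, $s$, $l$, $c$ (in the usual way); it is *strict* if $\alpha$ is an identity. A *tangent $2$-morphism* $\varphi\colon(F,\alpha)\Rightarrow(G,\beta)$ is a $2$-morphism $\varphi\colon F\Rightarrow G$ with $T'\varphi\circ\alpha=\beta\circ\varphi_T$. These form the $2$-category $\mathsf{Tng}(\mathbf K)$. Write $[\mathbb X',\mathbb T'\,|\,\mathbb X,\mathbb T]$ for its Hom-category, equipped with the tangent bundle functor $\bar T=(T,c)\circ(-)$ and the projection $\bar p=p\circ(-)$. A *vector field* in it is a pair of an object $(G,\beta)$ and a tangent $2$-morphism $u\colon(G,\beta)\Rightarrow\bar T(G,\beta)$ with $\bar p\circ u=\mathrm{id}$; a morphism $(G,\beta;u)\to(G',\beta';u')$ of vector fields is a tangent $2$-morphism $\varphi$ with $\bar T\varphi\circ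 u=u'\circ\varphi$. These form a category $\mathsf{VF}[\mathbb X',\mathbb T'\,|\,\mathbb X,\mathbb T]$. A lax tangent morphism $(F,\alpha)\colon(\mathbb X,\mathbb T)\to(\mathbb X',\mathbb T')$ induces functors $\mathsf{VF}[\mathbb Y,\mathbb S\,|\,F,\alpha]\colon\mathsf{VF}[\mathbb Y,\mathbb S\,|\,\mathbb X,\mathbb T]\to\mathsf{VF}[\mathbb Y,\mathbb S\,|\,\mathbb X',\mathbb T']$, $(G,\beta;u)\mapsto((F,\alpha)\circ(G,\beta);\ \alpha_G\circ Fu)$, $\psi\mapsto F\psi$, and a tangent $2$-morphism $\varphi\colon(F,\alpha)\Rightarrow(F',\alpha')$ induces a natural transformation $\mathsf{VF}[\mathbb Y,\mathbb S\,|\,\varphi]$ with components $\varphi_G$. A *tangentad of vector fields* of $(\mathbb X,\mathbb T)$ is a tangentad $\mathsf{VF}(\mathbb X,\mathbb T)$ with a strict tangent morphism $U\colon\mathsf{VF}(\mathbb X,\mathbb T)\to(\mathbb X,\mathbb T)$ and a vector field $\hat v\colon U\Rightarrow\bar TU$ in $[\mathsf{VF}(\mathbb X,\mathbb T)\,|\,\mathbb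 X,\mathbb T]$ (the *universal vector field*) such that for every tangentad $(\mathbb Y,\mathbb S)$ the functor $$\Gamma_{\hat v}\colon[\mathbb Y,\mathbb S\,|\,\mathsf{VF}(\mathbb X,\mathbb T)]\to\mathsf{VF}[\mathbb Y,\mathbb S\,|\,\mathbb X,\mathbb T],\qquad H\mapsto(U\circ H;\hat v_H),\quad \psi\mapsto U\psi,$$ is invertible (an isomorphism of categories). $\mathbf K$ *admits the construction of vector fields* if every tangentad of $\mathbf K$ has a tangentad of vector fields. **Proposition.** Let $\mathbf K$ be a $2$-category which admits the construction of vector fields. Then one can choose a tangentad of vector fields for every tangentad, and for every such choice $(\mathbb X,\mathbb T)\mapsto(\mathsf{VF}(\mathbb X,\mathbb T),U,\hat v)$ the assignment $(\mathbb X,\mathbb T)\mapsto\mathsf{VF}(\mathbb X,\mathbb T)$ extends to a (strict) $2$-functor $$\mathsf{VF}\colon\mathsf{Tng}(\mathbf K)\to\mathsf{Tng}(\mathbf K)$$ such that, for every lax tangent morphism $(F,\alpha)\colon(\mathbb X,\mathbb T)\to(\mathbb X',\mathbb T')$, with $\hat v'$ the universal vector field of $(\mathbb X',\mathbb T')$,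 $$\Gamma_{\hat v'}\big(\mathsf{VF}(F,\alpha)\big)=\mathsf{VF}[\mathsf{VF}(\mathbb X,\mathbb T)\,|\,F,\alpha](\hat v),$$ and for every tangent $2$-morphism $\varphi\colon(F,\alpha)\Rightarrow(G,\beta)$ $$\Gamma_{\hat v'}\big(\mathsf{VF}(\varphi)\big)=\mathsf{VF}[\mathsf{VF}(\mathbb X,\mathbb T)\,|\,\varphi]_{\hat v}.$$ -/

import Mathlib

open CategoryTheory CategoryTheory.Bicategory CategoryTheory.Limits

universe w v u

namespace Tangentads

/-! Throughout, composition is written in diagrammatic order: the composite `G ∘ F` of 1-morphisms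
is `F ≫ G`.  For a 2-morphism `η` and 1-morphisms `F`, `G`, the whiskering usually written `G η`
(apply `G` to `η`) is `η ▷ G`, and the one usually written `η_F` (restrict `η` along `F`) is
`F ◁ η`.  When the bicategory is strict, all associators `α_` and unitors `λ_`, `ρ_` are
identities. -/

/-- `b : P ⟶ M` and `π : Fin n → (P ⟶ E)` exhibit `P` as the `n`-fold pullback of `q : E ⟶ M`
along itself. -/
def IsFiberPower {C : Type*} [Category C] {E M P : C} (q : E ⟶ M) {n : ℕ} (b : P ⟶ M)
    (π : Fin n → (P ⟶ E)) : Prop :=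
  ∃ h : ∀ i, π i ≫ q = b,
    Nonempty (IsLimit (WidePullbackCone.mk (f := fun _ : Fin n => q) b π h))

/-- `h : Z ⟶ P` is the pairing `⟨f, g⟩` with respect to the projections `π₁`, `π₂` of `P`. -/
def IsPairing {C : Type*} [Category C] {E P Z : C} (π₁ π₂ : P ⟶ E) (h : Z ⟶ P) (f g : Z ⟶ E) :
    Prop :=
  h ≫ π₁ = f ∧ h ≫ π₂ = g

section Bicat

variable {K : Type u} [Bicategory.{w, v} K]

/-- The iterates of an endo-1-morphism. -/
def iter {x : K} (T : x ⟶ x) : ℕ → (x ⟶ x)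
  | 0 => 𝟙 x
  | n + 1 => iter T n ≫ T

end Bicat

/-- A tangentad in a 2-category `K`. -/
structure Tangentad (K : Type u) [Bicategory.{w, v} K] where
  /-- The base object. -/
  obj : K
  /-- The tangent bundle 1-morphism. -/
  T : obj ⟶ obj
  /-- The projection. -/
  p : T ⟶ 𝟙 obj
  /-- The projection admits all `n`-fold pullbacks along itself, pointwise and preserved by all
  iterates of `T`. -/
  fiberPowers : ∀ n : ℕ, ∃ (Tn : obj ⟶ obj) (b : Tn ⟶ 𝟙 obj) (π : Fin n → (Tn ⟶ T)),
    ∀ (y : K) (F : y ⟶ obj) (m : ℕ),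
      IsFiberPower ((F ◁ p) ▷ iter T m) ((F ◁ b) ▷ iter T m) (fun i => (F ◁ π i) ▷ iter T m)
  /-- The 2-fold pullback of the projection along itself. -/
  T₂ : obj ⟶ obj
  /-- The first projection of `T₂`. -/
  π₁ : T₂ ⟶ T
  /-- The second projection of `T₂`. -/
  π₂ : T₂ ⟶ T
  isPullback : ∀ (y : K) (F : y ⟶ obj) (m : ℕ),
    IsPullback ((F ◁ π₁) ▷ iter T m) ((F ◁ π₂) ▷ iter T m)
      ((F ◁ p) ▷ iter T m) ((F ◁ p) ▷ iter T m)
  /-- The zero morphism. -/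
  z : 𝟙 obj ⟶ T
  /-- The sum morphism. -/
  s : T₂ ⟶ T
  /-- The vertical lift. -/
  l : T ⟶ T ≫ T
  /-- The canonical flip. -/
  c : T ≫ T ⟶ T ≫ T
  -- `(p, z, s)` is an additive bundle
  zero_proj : z ≫ p = 𝟙 (𝟙 obj)
  sum_proj : s ≫ p = π₁ ≫ p
  sum_assoc : ∀ {Z : obj ⟶ obj} (xy yz xy_z x_yz : Z ⟶ T₂), xy ≫ π₂ = yz ≫ π₁ →
    IsPairing π₁ π₂ xy_z (xy ≫ s) (yz ≫ π₂) → IsPairing π₁ π₂ x_yz (xy ≫ π₁) (yz ≫ s) →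
    xy_z ≫ s = x_yz ≫ s
  sum_zero : ∃ h : T ⟶ T₂, IsPairing π₁ π₂ h (p ≫ z) (𝟙 T) ∧ h ≫ s = 𝟙 T
  sum_comm : ∃ τ : T₂ ⟶ T₂, IsPairing π₁ π₂ τ π₂ π₁ ∧ τ ≫ s = s
  -- `(z, l)` is an additive bundle morphism from `p` to `T p`
  lift_proj : l ≫ p ▷ T ≫ (λ_ T).hom = p ≫ z
  lift_zero : z ≫ l = z ≫ (λ_ T).inv ≫ z ▷ T
  lift_sum : ∃ h : T₂ ⟶ T₂ ≫ T, IsPairing (π₁ ▷ T) (π₂ ▷ T) h (π₁ ≫ l) (π₂ ≫ l) ∧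
    h ≫ s ▷ T = s ≫ l
  -- `(id, c)` is an additive bundle morphism from `T p` to `p_T`
  flip_proj : c ≫ T ◁ p ≫ (ρ_ T).hom = p ▷ T ≫ (λ_ T).hom
  flip_zero : (λ_ T).inv ≫ z ▷ T ≫ c = (ρ_ T).inv ≫ T ◁ z
  flip_sum : ∃ h : T₂ ≫ T ⟶ T ≫ T₂,
    IsPairing (T ◁ π₁) (T ◁ π₂) h (π₁ ▷ T ≫ c) (π₂ ▷ T ≫ c) ∧ h ≫ T ◁ s = s ▷ T ≫ c
  -- coassociativity of the lift and its compatibility with the flip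
  lift_coassoc : l ≫ l ▷ T ≫ (α_ T T T).hom = l ≫ T ◁ l
  lift_flip : l ≫ c = l
  lift_flip_flip : T ◁ l ≫ (α_ T T T).inv ≫ c ▷ T ≫ (α_ T T T).hom ≫ T ◁ c =
    c ≫ l ▷ T ≫ (α_ T T T).hom
  -- the flip is a symmetric braiding
  flip_flip : c ≫ c = 𝟙 (T ≫ T)
  flip_braid : c ▷ T ≫ (α_ T T T).hom ≫ T ◁ c ≫ (α_ T T T).inv ≫ c ▷ T ≫ (α_ T T T).hom =
    (α_ T T T).hom ≫ T ◁ c ≫ (α_ T T T).inv ≫ c ▷ T ≫ (α_ T T T).hom ≫ T ◁ c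
  /-- The tangent bundle is locally linear: a pointwise pullback. -/
  lift_universal : ∃ h : T₂ ⟶ T₂ ≫ T,
    IsPairing (π₁ ▷ T) (π₂ ▷ T) h (π₁ ≫ l) (π₂ ≫ (ρ_ T).inv ≫ T ◁ z) ∧
    ∀ (y : K) (F : y ⟶ obj),
      IsPullback (F ◁ (h ≫ s ▷ T)) (F ◁ (π₁ ≫ p)) (F ◁ (p ▷ T ≫ (λ_ T).hom)) (F ◁ z)

section Bicat

variable {K : Type u} [Bicategory.{w, v} K]

/-- The composite `(T'α) ∘ (α_T) : F ∘ T² ⟶ T'² ∘ F`. -/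
def square {x y : K} {T : x ⟶ x} {T' : y ⟶ y} {F : x ⟶ y} (a : T ≫ F ⟶ F ≫ T') :
    (T ≫ T) ≫ F ⟶ F ≫ T' ≫ T' :=
  (α_ T T F).hom ≫ T ◁ a ≫ (α_ T F T').inv ≫ a ▷ T' ≫ (α_ F T' T').hom

/-- A lax tangent 1-morphism. -/
@[ext]
structure LaxHom (X Y : Tangentad K) where
  /-- The underlying 1-morphism. -/
  F : X.obj ⟶ Y.obj
  /-- The lax distributive law `F ∘ T ⟶ T' ∘ F`. -/
  dist : X.T ≫ F ⟶ F ≫ Y.T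
  dist_proj : dist ≫ F ◁ Y.p ≫ (ρ_ F).hom = X.p ▷ F ≫ (λ_ F).hom
  dist_zero : (λ_ F).inv ≫ X.z ▷ F ≫ dist = (ρ_ F).inv ≫ F ◁ Y.z
  dist_sum : ∃ h : X.T₂ ≫ F ⟶ F ≫ Y.T₂,
    IsPairing (F ◁ Y.π₁) (F ◁ Y.π₂) h (X.π₁ ▷ F ≫ dist) (X.π₂ ▷ F ≫ dist) ∧
      h ≫ F ◁ Y.s = X.s ▷ F ≫ dist
  dist_lift : X.l ▷ F ≫ square dist = dist ≫ F ◁ Y.l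
  dist_flip : X.c ▷ F ≫ square dist = square dist ≫ F ◁ Y.c

/-- A tangent 2-morphism between lax tangent 1-morphisms. -/
@[ext]
structure TwoHom {X Y : Tangentad K} (F G : LaxHom X Y) where
  /-- The underlying 2-morphism. -/
  hom : F.F ⟶ G.F
  comm : F.dist ≫ hom ▷ Y.T = X.T ◁ hom ≫ G.dist

instance (X Y : Tangentad K) : Category (LaxHom X Y) where
  Hom F G := TwoHom F G
  id F := ⟨𝟙 _, by simp⟩
  comp φ ψ := ⟨φ.hom ≫ ψ.hom, by
    rw [comp_whiskerRight, ← Category.assoc, φ.comm, Category.assoc, ψ.comm]; simp⟩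

@[ext]
theorem LaxHom.hom_ext {X Y : Tangentad K} {F G : LaxHom X Y} {φ ψ : F ⟶ G}
    (h : φ.hom = ψ.hom) : φ = ψ := TwoHom.ext h

@[simp] theorem id_hom {X Y : Tangentad K} (F : LaxHom X Y) : TwoHom.hom (𝟙 F) = 𝟙 F.F := rfl
@[simp] theorem comp_hom {X Y : Tangentad K} {F G H : LaxHom X Y} (φ : F ⟶ G) (ψ : G ⟶ H) :
    (φ ≫ ψ).hom = φ.hom ≫ ψ.hom := rfl

/-- An invertible 2-morphism of `K` compatible with the distributive laws is an invertible tangent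
2-morphism. -/
abbrev mkIso {X Y : Tangentad K} {F G : LaxHom X Y} (e : F.F ≅ G.F)
    (h : F.dist ≫ e.hom ▷ Y.T = X.T ◁ e.hom ≫ G.dist) : F ≅ G where
  hom := ⟨e.hom, h⟩
  inv := ⟨e.inv, by
    rw [← cancel_epi (X.T ◁ e.hom), ← Category.assoc, ← h]; simp⟩
  hom_inv_id := by ext; simp
  inv_hom_id := by ext; simp

/-- The identity lax tangent 1-morphism. -/
abbrev LaxHom.id (X : Tangentad K) : LaxHom X X where
  F := 𝟙 X.obj
  dist := (ρ_ X.T).hom ≫ (λ_ X.T).inv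
  dist_proj := by simp
  dist_zero := by simp
  dist_sum := ⟨(ρ_ X.T₂).hom ≫ (λ_ X.T₂).inv, by simp [IsPairing], by simp⟩
  dist_lift := by simp [square]
  dist_flip := by simp [square]

theorem square_comp {x y z : K} {T : x ⟶ x} {T' : y ⟶ y} {T'' : z ⟶ z} {F : x ⟶ y} {G : y ⟶ z}
    (a : T ≫ F ⟶ F ≫ T') (b : T' ≫ G ⟶ G ≫ T'') :
    square ((α_ T F G).inv ≫ a ▷ G ≫ (α_ F T' G).hom ≫ F ◁ b ≫ (α_ F G T'').inv) =
      (α_ (T ≫ T) F G).inv ≫ square a ▷ G ≫ (α_ F (T' ≫ T') G).hom ≫ F ◁ square b ≫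
        (α_ F G (T'' ≫ T'')).inv := by
  have key : T ◁ F ◁ b ≫ (α_ T F (G ≫ T'')).inv ≫ a ▷ (G ≫ T'') =
      (α_ T F (T' ≫ G)).inv ≫ a ▷ (T' ≫ G) ≫ (F ≫ T') ◁ b := by
    rw [← whisker_exchange]; simp
  have key' := congrArg (fun t => (α_ T T (F ≫ G)).hom ≫ T ◁ (α_ T F G).inv ≫ T ◁ (a ▷ G) ≫
    T ◁ (α_ F T' G).hom ≫ t ≫ (α_ _ _ _).hom ≫ F ◁ (α_ _ _ _).inv ≫ F ◁ (b ▷ T'') ≫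
    F ◁ (α_ _ _ _).hom ≫ (α_ _ _ _).inv) key
  simp only [square]
  convert key' using 1
  · bicategory
  · bicategory

/-- The composite of lax tangent 1-morphisms. -/
abbrev LaxHom.comp {X Y Z : Tangentad K} (F : LaxHom X Y) (G : LaxHom Y Z) : LaxHom X Z where
  F := F.F ≫ G.F
  dist := (α_ X.T F.F G.F).inv ≫ F.dist ▷ G.F ≫ (α_ F.F Y.T G.F).hom ≫ F.F ◁ G.dist ≫
    (α_ F.F G.F Z.T).inv
  dist_proj := by
    trans (α_ X.T F.F G.F).inv ≫ F.dist ▷ G.F ≫ (α_ F.F Y.T G.F).hom ≫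
        F.F ◁ (G.dist ≫ G.F ◁ Z.p ≫ (ρ_ G.F).hom)
    · bicategory
    · rw [G.dist_proj]
      trans (α_ X.T F.F G.F).inv ≫ (F.dist ≫ F.F ◁ Y.p ≫ (ρ_ F.F).hom) ▷ G.F
      · bicategory
      · rw [F.dist_proj]
        bicategory
  dist_zero := by
    trans ((λ_ F.F).inv ≫ X.z ▷ F.F ≫ F.dist) ▷ G.F ≫ (α_ F.F Y.T G.F).hom ≫ F.F ◁ G.dist ≫
        (α_ F.F G.F Z.T).inv
    · bicategory
    · rw [F.dist_zero]
      trans F.F ◁ ((λ_ G.F).inv ≫ Y.z ▷ G.F ≫ G.dist) ≫ (α_ F.F G.F Z.T).inv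
      · bicategory
      · rw [G.dist_zero]
        bicategory
  dist_sum := by
    obtain ⟨h, ⟨h1, h2⟩, h3⟩ := F.dist_sum
    obtain ⟨k, ⟨k1, k2⟩, k3⟩ := G.dist_sum
    have aux : ∀ (q : Y.T₂ ⟶ Y.T) (q' : Z.T₂ ⟶ Z.T) (q₀ : X.T₂ ⟶ X.T),
        h ≫ F.F ◁ q = q₀ ▷ F.F ≫ F.dist → k ≫ G.F ◁ q' = q ▷ G.F ≫ G.dist →
        ((α_ X.T₂ F.F G.F).inv ≫ h ▷ G.F ≫ (α_ F.F Y.T₂ G.F).hom ≫ F.F ◁ k ≫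
          (α_ F.F G.F Z.T₂).inv) ≫ (F.F ≫ G.F) ◁ q' =
        q₀ ▷ (F.F ≫ G.F) ≫ (α_ X.T F.F G.F).inv ≫ F.dist ▷ G.F ≫ (α_ F.F Y.T G.F).hom ≫
          F.F ◁ G.dist ≫ (α_ F.F G.F Z.T).inv := by
      intro q q' q₀ e1 e2
      trans (α_ X.T₂ F.F G.F).inv ≫ h ▷ G.F ≫ (α_ F.F Y.T₂ G.F).hom ≫ F.F ◁ (k ≫ G.F ◁ q') ≫
          (α_ F.F G.F Z.T).inv
      · bicategory
      · rw [e2]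
        trans (α_ X.T₂ F.F G.F).inv ≫ (h ≫ F.F ◁ q) ▷ G.F ≫ (α_ F.F Y.T G.F).hom ≫
          F.F ◁ G.dist ≫ (α_ F.F G.F Z.T).inv
        · bicategory
        · rw [e1]
          bicategory
    exact ⟨_, ⟨aux _ _ _ h1 k1, aux _ _ _ h2 k2⟩, aux _ _ _ h3 k3⟩
  dist_lift := by
    rw [square_comp]
    trans (α_ X.T F.F G.F).inv ≫ (X.l ▷ F.F ≫ square F.dist) ▷ G.F ≫
      (α_ F.F (Y.T ≫ Y.T) G.F).hom ≫ F.F ◁ square G.dist ≫ (α_ F.F G.F (Z.T ≫ Z.T)).inv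
    · bicategory
    · rw [F.dist_lift]
      trans (α_ X.T F.F G.F).inv ≫ F.dist ▷ G.F ≫
        (α_ F.F Y.T G.F).hom ≫ F.F ◁ (Y.l ▷ G.F ≫ square G.dist) ≫ (α_ F.F G.F (Z.T ≫ Z.T)).inv
      · bicategory
      · rw [G.dist_lift]
        bicategory
  dist_flip := by
    rw [square_comp]
    trans (α_ (X.T ≫ X.T) F.F G.F).inv ≫ (X.c ▷ F.F ≫ square F.dist) ▷ G.F ≫
      (α_ F.F (Y.T ≫ Y.T) G.F).hom ≫ F.F ◁ square G.dist ≫ (α_ F.F G.F (Z.T ≫ Z.T)).inv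
    · bicategory
    · rw [F.dist_flip]
      trans (α_ (X.T ≫ X.T) F.F G.F).inv ≫ square F.dist ▷ G.F ≫
        (α_ F.F (Y.T ≫ Y.T) G.F).hom ≫ F.F ◁ (Y.c ▷ G.F ≫ square G.dist) ≫
        (α_ F.F G.F (Z.T ≫ Z.T)).inv
      · bicategory
      · rw [G.dist_flip]
        bicategory

/-- Tangentads, lax tangent 1-morphisms and tangent 2-morphisms form the 2-category `Tng(K)`. -/
instance : Bicategory (Tangentad K) where
  Hom X Y := LaxHom X Y
  id X := LaxHom.id X
  comp F G := LaxHom.comp F G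
  homCategory X Y := inferInstance
  whiskerLeft {X Y Z} F {G H} φ := ⟨F.F ◁ φ.hom, by
    trans (α_ X.T F.F G.F).inv ≫ F.dist ▷ G.F ≫ (α_ F.F Y.T G.F).hom ≫
      F.F ◁ (G.dist ≫ φ.hom ▷ Z.T) ≫ (α_ F.F H.F Z.T).inv
    · dsimp; bicategory
    · rw [φ.comm]
      trans (α_ X.T F.F G.F).inv ≫ (F.dist ▷ G.F ≫ (F.F ≫ Y.T) ◁ φ.hom) ≫
        (α_ F.F Y.T H.F).hom ≫ F.F ◁ H.dist ≫ (α_ F.F H.F Z.T).inv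
      · bicategory
      · rw [← whisker_exchange]
        dsimp; bicategory⟩
  whiskerRight {X Y Z} {F G} φ H := ⟨φ.hom ▷ H.F, by
    trans (α_ X.T F.F H.F).inv ≫ F.dist ▷ H.F ≫ (α_ F.F Y.T H.F).hom ≫
      (F.F ◁ H.dist ≫ φ.hom ▷ (H.F ≫ Z.T)) ≫ (α_ G.F H.F Z.T).inv
    · dsimp; bicategory
    · rw [whisker_exchange]
      trans (α_ X.T F.F H.F).inv ≫ (F.dist ≫ φ.hom ▷ Y.T) ▷ H.F ≫
        (α_ G.F Y.T H.F).hom ≫ G.F ◁ H.dist ≫ (α_ G.F H.F Z.T).inv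
      · bicategory
      · rw [φ.comm]
        dsimp; bicategory⟩
  associator F G H := mkIso (α_ F.F G.F H.F) (by dsimp; bicategory)
  leftUnitor F := mkIso (λ_ F.F) (by dsimp; bicategory)
  rightUnitor F := mkIso (ρ_ F.F) (by dsimp; bicategory)
  whiskerLeft_id _ _ := by ext; simp
  whiskerLeft_comp _ _ _ _ _ _ := by ext; simp
  id_whiskerLeft _ := by ext; simp
  comp_whiskerLeft _ _ _ _ _ := by ext; simp
  id_whiskerRight _ _ := by ext; simp
  comp_whiskerRight _ _ _ := by ext; simp
  whiskerRight_id _ := by ext; simp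
  whiskerRight_comp _ _ _ := by ext; simp
  whisker_assoc _ _ _ _ _ := by ext; simp
  whisker_exchange _ _ := by ext; simp [whisker_exchange]
  pentagon _ _ _ _ := by ext; simp
  triangle _ _ := by ext; simp

theorem LaxHom.eq_of_eqToHom {X Y : Tangentad K} {F G : LaxHom X Y} (h : F.F = G.F)
    (w : F.dist ≫ eqToHom h ▷ Y.T = X.T ◁ eqToHom h ≫ G.dist) : F = G := by
  cases F; cases G
  cases h
  simp at w
  subst w
  rfl

theorem eqToHom_hom {X Y : Tangentad K} {F G : X ⟶ Y} (h : F = G) :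
    TwoHom.hom (eqToHom h) = eqToHom (congrArg LaxHom.F h) := by
  cases h; rfl

@[simp] theorem leftUnitor_hom_hom {X Y : Tangentad K} (F : X ⟶ Y) :
    TwoHom.hom (λ_ F).hom = (λ_ F.F).hom := rfl
@[simp] theorem leftUnitor_inv_hom {X Y : Tangentad K} (F : X ⟶ Y) :
    TwoHom.hom (λ_ F).inv = (λ_ F.F).inv := rfl
@[simp] theorem rightUnitor_hom_hom {X Y : Tangentad K} (F : X ⟶ Y) :
    TwoHom.hom (ρ_ F).hom = (ρ_ F.F).hom := rfl
@[simp] theorem rightUnitor_inv_hom {X Y : Tangentad K} (F : X ⟶ Y) :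
    TwoHom.hom (ρ_ F).inv = (ρ_ F.F).inv := rfl
@[simp] theorem associator_hom_hom {X Y Z W : Tangentad K} (F : X ⟶ Y) (G : Y ⟶ Z) (H : Z ⟶ W) :
    TwoHom.hom (α_ F G H).hom = (α_ F.F G.F H.F).hom := rfl
@[simp] theorem associator_inv_hom {X Y Z W : Tangentad K} (F : X ⟶ Y) (G : Y ⟶ Z) (H : Z ⟶ W) :
    TwoHom.hom (α_ F G H).inv = (α_ F.F G.F H.F).inv := rfl
@[simp] theorem whiskerLeft_hom {X Y Z : Tangentad K} (F : X ⟶ Y) {G H : Y ⟶ Z} (φ : G ⟶ H) :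
    TwoHom.hom (F ◁ φ) = F.F ◁ φ.hom := rfl
@[simp] theorem whiskerRight_hom {X Y Z : Tangentad K} {F G : X ⟶ Y} (φ : F ⟶ G) (H : Y ⟶ Z) :
    TwoHom.hom (φ ▷ H) = φ.hom ▷ H.F := rfl

theorem comp_dist {X Y Z : Tangentad K} (F : X ⟶ Y) (G : Y ⟶ Z) :
    LaxHom.dist (F ≫ G) = (α_ X.T F.F G.F).inv ≫ F.dist ▷ G.F ≫ (α_ F.F Y.T G.F).hom ≫
      F.F ◁ G.dist ≫ (α_ F.F G.F Z.T).inv := rfl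

/-- If `K` is strict, so is `Tng(K)`. -/
instance [Strict K] : Strict (Tangentad K) :=
  have e₁ {X Y : Tangentad K} (F : X ⟶ Y) : 𝟙 X ≫ F = F :=
    LaxHom.eq_of_eqToHom (Strict.id_comp F.F) (by
      have := (λ_ F).hom.comm
      rwa [leftUnitor_hom_hom, Strict.leftUnitor_eqToIso] at this)
  have e₂ {X Y : Tangentad K} (F : X ⟶ Y) : F ≫ 𝟙 Y = F :=
    LaxHom.eq_of_eqToHom (Strict.comp_id F.F) (by
      have := (ρ_ F).hom.comm
      rwa [rightUnitor_hom_hom, Strict.rightUnitor_eqToIso] at this)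
  have e₃ {X Y Z W : Tangentad K} (F : X ⟶ Y) (G : Y ⟶ Z) (H : Z ⟶ W) :
      (F ≫ G) ≫ H = F ≫ G ≫ H :=
    LaxHom.eq_of_eqToHom (Strict.assoc F.F G.F H.F) (by
      have := (α_ F G H).hom.comm
      rwa [associator_hom_hom, Strict.associator_eqToIso] at this)
  { id_comp := e₁
    comp_id := e₂
    assoc := e₃
    leftUnitor_eqToIso := fun F => Iso.ext (LaxHom.hom_ext
      ((congrArg Iso.hom (Strict.leftUnitor_eqToIso F.F)).trans (eqToHom_hom (e₁ F)).symm))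
    rightUnitor_eqToIso := fun F => Iso.ext (LaxHom.hom_ext
      ((congrArg Iso.hom (Strict.rightUnitor_eqToIso F.F)).trans (eqToHom_hom (e₂ F)).symm))
    associator_eqToIso := fun F G H => Iso.ext (LaxHom.hom_ext
      ((congrArg Iso.hom (Strict.associator_eqToIso F.F G.F H.F)).trans
        (eqToHom_hom (e₃ F G H)).symm)) }

/-- A strict tangent 1-morphism: a lax one whose distributive law is the identity. -/
def IsStrict {X Y : Tangentad K} (F : X ⟶ Y) : Prop :=
  ∃ h : X.T ≫ F.F = F.F ≫ Y.T, F.dist = eqToHom h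

/-- The tangent bundle 1-morphism as a lax tangent 1-morphism `(T, c)` of `(X, T)` to itself. -/
abbrev bundle (X : Tangentad K) : X ⟶ X where
  F := X.T
  dist := X.c
  dist_proj := X.flip_proj
  dist_zero := X.flip_zero
  dist_sum := X.flip_sum
  dist_lift := by
    have e := congrArg (fun t => X.c ≫ t ≫ X.T ◁ X.c ≫ (α_ X.T X.T X.T).inv ≫ X.c ▷ X.T ≫
      (α_ X.T X.T X.T).hom) X.lift_flip_flip
    have h1 {Z : X.obj ⟶ X.obj} (k : X.T ≫ X.T ⟶ Z) : X.c ≫ X.c ≫ k = k := by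
      rw [← Category.assoc, X.flip_flip, Category.id_comp]
    have h2 {Z : X.obj ⟶ X.obj} (k : X.T ≫ X.T ≫ X.T ⟶ Z) : X.T ◁ X.c ≫ X.T ◁ X.c ≫ k = k := by
      rw [← Category.assoc, ← whiskerLeft_comp, X.flip_flip, whiskerLeft_id, Category.id_comp]
    have h3 {Z : X.obj ⟶ X.obj} (k : (X.T ≫ X.T) ≫ X.T ⟶ Z) : X.c ▷ X.T ≫ X.c ▷ X.T ≫ k = k := by
      rw [← Category.assoc, ← comp_whiskerRight, X.flip_flip, id_whiskerRight, Category.id_comp]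
    simp only [Category.assoc, h1, h2, Iso.hom_inv_id_assoc, h3, Iso.inv_hom_id,
      Category.comp_id] at e
    exact e.symm
  dist_flip := by
    simpa [square] using X.flip_braid

/-- The projection as a tangent 2-morphism `(T, c) ⟶ id`. -/
abbrev bundleProj (X : Tangentad K) : bundle X ⟶ 𝟙 X where
  hom := X.p
  comm := by
    have h := X.flip_proj
    have h1 := congrArg (fun t => X.c ≫ t ≫ (λ_ X.T).inv) h
    simp only [Category.assoc, Iso.hom_inv_id, Category.comp_id] at h1
    rw [← Category.assoc X.c X.c, X.flip_flip, Category.id_comp] at h1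
    exact h1.symm

/-- The distributive law of a lax tangent 1-morphism `(F, α)` as a tangent 2-morphism
`(F, α) ∘ (T, c) ⟶ (T', c') ∘ (F, α)`. -/
abbrev distHom {X Y : Tangentad K} (F : X ⟶ Y) : bundle X ≫ F ⟶ F ≫ bundle Y where
  hom := F.dist
  comm := by
    have := F.dist_flip
    trans (α_ X.T X.T F.F).inv ≫ (X.c ▷ F.F ≫ square F.dist) ≫ (α_ F.F Y.T Y.T).inv
    · rw [comp_dist]; dsimp only [square]; bicategory
    · rw [this, comp_dist]
      dsimp only [square]; bicategory

theorem distHom_proj {X Y : Tangentad K} (F : X ⟶ Y) :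
    distHom F ≫ F ◁ bundleProj Y ≫ (ρ_ F).hom = bundleProj X ▷ F ≫ (λ_ F).hom :=
  LaxHom.hom_ext F.dist_proj

theorem distHom_naturality {X Y : Tangentad K} {F G : X ⟶ Y} (φ : F ⟶ G) :
    distHom F ≫ φ ▷ bundle Y = bundle X ◁ φ ≫ distHom G :=
  LaxHom.hom_ext φ.comm

end Bicat

/-! ### Vector fields -/

/-- A vector field in a category with tangent bundle functor `T` and projection `p`: an object
with a section of the projection of its tangent bundle. -/
structure VectorField {C : Type*} [Category C] (T : C ⥤ C) (p : T ⟶ 𝟭 C) where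
  /-- The base object. -/
  base : C
  /-- The section. -/
  field : base ⟶ T.obj base
  field_proj : field ≫ p.app base = 𝟙 base

/-- A morphism of vector fields. -/
@[ext]
structure VectorField.Hom {C : Type*} [Category C] {T : C ⥤ C} {p : T ⟶ 𝟭 C}
    (v u : VectorField T p) where
  /-- The underlying morphism. -/
  hom : v.base ⟶ u.base
  comm : v.field ≫ T.map hom = hom ≫ u.field

instance {C : Type*} [Category C] (T : C ⥤ C) (p : T ⟶ 𝟭 C) : Category (VectorField T p) where
  Hom v u := VectorField.Hom v u
  id v := ⟨𝟙 v.base, by simp⟩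
  comp f g := ⟨f.hom ≫ g.hom, by
    rw [T.map_comp, ← Category.assoc, f.comm, Category.assoc, g.comm, Category.assoc]⟩

@[ext]
theorem VectorField.hom_ext {C : Type*} [Category C] {T : C ⥤ C} {p : T ⟶ 𝟭 C}
    {v u : VectorField T p} {f g : v ⟶ u} (h : f.hom = g.hom) : f = g := VectorField.Hom.ext h

@[simp] theorem VectorField.id_hom {C : Type*} [Category C] {T : C ⥤ C} {p : T ⟶ 𝟭 C}
    (v : VectorField T p) : VectorField.Hom.hom (𝟙 v) = 𝟙 v.base := rfl
@[simp] theorem VectorField.comp_hom {C : Type*} [Category C] {T : C ⥤ C} {p : T ⟶ 𝟭 C}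
    {u v w : VectorField T p} (f : u ⟶ v) (g : v ⟶ w) : (f ≫ g).hom = f.hom ≫ g.hom := rfl

section Bicat

variable {K : Type u} [Bicategory.{w, v} K]

/-- The tangent bundle functor of the Hom-tangent category `[Y | X]` of lax tangent 1-morphisms
from `Y` to `X`: postcomposition with `(T, c)`. -/
abbrev homBundle (Y X : Tangentad K) : (Y ⟶ X) ⥤ (Y ⟶ X) where
  obj G := G ≫ bundle X
  map φ := φ ▷ bundle X

/-- The projection of the Hom-tangent category `[Y | X]`. -/
abbrev homProj (Y X : Tangentad K) : homBundle Y X ⟶ 𝟭 (Y ⟶ X) where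
  app G := G ◁ bundleProj X ≫ (ρ_ G).hom
  naturality G H φ := by
    have h := whisker_exchange φ (bundleProj X)
    simp only [Functor.id_map, Category.assoc]
    rw [← reassoc_of% h]
    simp

/-- The category `VF[Y | X]` of vector fields of the Hom-tangent category `[Y | X]`. -/
abbrev HomVF (Y X : Tangentad K) := VectorField (homBundle Y X) (homProj Y X)

/-- The functor `Γ_u : [Z | Y] ⥤ VF[Z | X]` induced by a vector field `(G, β; u)` of `[Y | X]`. It
sends `H` to the vector field `u_H` on `G ∘ H`. -/
abbrev induced {Y X : Tangentad K} (u : HomVF Y X) (Z : Tangentad K) : (Z ⟶ Y) ⥤ HomVF Z X where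
  obj H :=
    { base := H ≫ u.base
      field := H ◁ u.field ≫ (α_ H u.base (bundle X)).inv
      field_proj := by
        have h := congrArg (fun t => H ◁ t) u.field_proj
        simp only [whiskerLeft_comp, whiskerLeft_id] at h
        simpa using h }
  map {H H'} φ :=
    { hom := φ ▷ u.base
      comm := by
        have h := whisker_exchange φ u.field
        simp only [Category.assoc] at h ⊢
        rw [← reassoc_of% h]
        simp }
  map_id H := by ext; simp
  map_comp φ ψ := by ext; simp

/-- The functor `VF[Z | F, α] : VF[Z | X] ⥤ VF[Z | Y]` induced by a lax tangent 1-morphism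
`(F, α) : X ⟶ Y`. It sends `(G, β; u)` to the vector field `α_G ∘ F u` on `F ∘ G`. -/
abbrev pushforward (Z : Tangentad K) {X Y : Tangentad K} (F : X ⟶ Y) : HomVF Z X ⥤ HomVF Z Y where
  obj u :=
    { base := u.base ≫ F
      field := u.field ▷ F ≫ (α_ u.base (bundle X) F).hom ≫ u.base ◁ distHom F ≫
        (α_ u.base F (bundle Y)).inv
      field_proj := by
        have h := distHom_proj F
        have h' := congrArg (fun t => t ▷ F) u.field_proj
        simp only [comp_whiskerRight, id_whiskerRight, whisker_assoc, Category.assoc] at h'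
        trans u.field ▷ F ≫ (α_ u.base (bundle X) F).hom ≫
          u.base ◁ (distHom F ≫ F ◁ bundleProj Y ≫ (ρ_ F).hom)
        · simp only [whiskerLeft_comp, comp_whiskerLeft, Category.assoc, Iso.inv_hom_id_assoc,
            whiskerLeft_rightUnitor]
        · rw [h, ← h']
          simp }
  map {u u'} f :=
    { hom := f.hom ▷ F
      comm := by
        have h := congrArg (fun t => t ▷ F) f.comm
        have h' := whisker_exchange f.hom (distHom F)
        simp only [comp_whiskerRight] at h ⊢
        simp only [Category.assoc]
        rw [← reassoc_of% h, associator_naturality_left_assoc, ← reassoc_of% h']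
        simp }
  map_id H := by ext; simp
  map_comp φ ψ := by ext; simp

/-- The natural transformation `VF[Z | φ]` induced by a tangent 2-morphism `φ`. -/
abbrev pushforward₂ (Z : Tangentad K) {X Y : Tangentad K} {F G : X ⟶ Y} (φ : F ⟶ G) :
    pushforward Z F ⟶ pushforward Z G where
  app u :=
    { hom := u.base ◁ φ
      comm := by
        have h := whisker_exchange u.field φ
        have h' := congrArg (fun t => u.base ◁ t) (distHom_naturality φ)
        simp only [whiskerLeft_comp] at h'
        simp only [Category.assoc]
        rw [reassoc_of% h, comp_whiskerLeft, whisker_assoc]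
        simp only [Category.assoc, Iso.inv_hom_id_assoc]
        rw [reassoc_of% h'] }
  naturality u u' f := by
    ext; simp [whisker_exchange]

/-- Universal vector fields: `V` is a tangentad of vector fields of `X`, that is, it comes with a
strict tangent 1-morphism `U : V ⟶ X` and a vector field `v : U ⟶ T̄ U` in `[V | X]` for which all
the functors `Γ_v : [Y | V] ⥤ VF[Y | X]` are invertible. -/
structure UniversalVectorField (V X : Tangentad K) where
  /-- The universal vector field; its base object is the strict tangent 1-morphism `U`. -/
  v : HomVF V X
  strict : IsStrict v.base
  universal : ∀ Y : Tangentad K, ∃ inv : HomVF Y X ⥤ (Y ⟶ V),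
    induced v Y ⋙ inv = 𝟭 (Y ⟶ V) ∧ inv ⋙ induced v Y = 𝟭 (HomVF Y X)

/-- `K` admits the construction of vector fields: every tangentad of `K` does. -/
def AdmitsVectorFields (K : Type u) [Bicategory.{w, v} K] : Prop :=
  ∀ X : Tangentad K, ∃ V : Tangentad K, Nonempty (UniversalVectorField V X)

/-- The 2-functor `VF`, whose values on objects are tangentads of vector fields, acts on lax
tangent 1-morphisms and tangent 2-morphisms through the universal property: `VF(F, α)` corresponds
under `Γ` to the image of the universal vector field under `VF[VF(X) | F, α]`, and `VF(φ)` to the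
component of `VF[VF(X) | φ]` at the universal vector field. -/
def ActsByUniversalProperty (VF : StrictPseudofunctor (Tangentad K) (Tangentad K))
    (U : ∀ X : Tangentad K, UniversalVectorField (VF.obj X) X) : Prop :=
  ∃ h : ∀ {X Y : Tangentad K} (F : X ⟶ Y),
      (induced (U Y).v (VF.obj X)).obj (VF.map F) = (pushforward (VF.obj X) F).obj (U X).v,
    ∀ {X Y : Tangentad K} {F G : X ⟶ Y} (φ : F ⟶ G),
      (induced (U Y).v (VF.obj X)).map (VF.map₂ φ) =
        eqToHom (h F) ≫ (pushforward₂ (VF.obj X) φ).app (U X).v ≫ eqToHom (h G).symm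

end Bicat
end Tangentads

open Tangentads

namespace Tangentads

/-! Since each $\Gamma_{\hat v'}$ is an isomorphism of categories, the two prescribed equations
determine $\mathsf{VF}$: bijectivity on objects defines it on 1-morphisms (`vfMap`), full
faithfulness on 2-morphisms (`vfMap₂`). Only the laws of a strict 2-functor remain, and each is
checked after applying $\Gamma$.

On 1-morphisms, write $F_*$ for pushforward of vector fields. The laws reduce to
$\Gamma_u(\mathrm{id}) = u$, $\mathrm{id}_* u = u$, $\Gamma_u(H' \circ H) =
\Gamma_{\Gamma_u(H')}(H)$, $F_*\Gamma_u(H) = \Gamma_{F_*u}(H)$ and $G_*F_*u = (G \circ F)_*u$. In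
each, a unitor or associator of $\mathsf{Tng}(\mathbf K)$ is compatible with the fields, and
strictness makes it an identity.

On 2-morphisms, $\Gamma$ is faithful and a morphism of vector fields is determined by its underlying
2-morphism. So it suffices to compare whiskerings with $U$, where $U\,\mathsf{VF}(\varphi) =
\varphi_U$ up to the identification $U \circ \mathsf{VF}(F) = F \circ U$. -/

/-- Two vector fields are equal when their base objects are and the identification of these is a
morphism of vector fields. -/
theorem VectorField.eq_of_eqToHom {C : Type*} [Category C] {T : C ⥤ C} {p : T ⟶ 𝟭 C}
    {u v : VectorField T p} (h : u.base = v.base)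
    (w : u.field ≫ T.map (eqToHom h) = eqToHom h ≫ v.field) : u = v := by
  cases u; cases v
  cases h
  simp at w
  subst w
  rfl

theorem VectorField.eqToHom_hom {C : Type*} [Category C] {T : C ⥤ C} {p : T ⟶ 𝟭 C}
    {u v : VectorField T p} (h : u = v) :
    VectorField.Hom.hom (eqToHom h) = eqToHom (congrArg VectorField.base h) := by
  cases h; rfl

/-- Equal 1-morphisms cannot be rewritten inside a whiskering without changing its type; the
`eqToHom`s absorb that change. Used with `vfMap_comp_base`, which is a propositional equality only.
-/
theorem whiskerLeft_congr {B : Type*} [Bicategory B] {a b c : B} {f f' : a ⟶ b} (h : f = f')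
    {g g' : b ⟶ c} (η : g ⟶ g') :
    f ◁ η = eqToHom (congrArg (· ≫ g) h) ≫ f' ◁ η ≫ eqToHom (congrArg (· ≫ g') h.symm) := by
  cases h; simp

theorem whiskerRight_congr {B : Type*} [Bicategory B] {a b c : B} {f f' : a ⟶ b} (η : f ⟶ f')
    {g g' : b ⟶ c} (h : g = g') :
    η ▷ g = eqToHom (congrArg (f ≫ ·) h) ≫ η ▷ g' ≫ eqToHom (congrArg (f' ≫ ·) h.symm) := by
  cases h; simp

/-! ### Strict compatibility of $\Gamma$ and pushforward with identities and composition -/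

section Strict

variable {K : Type u} [Bicategory.{w, v} K]

/-- An identification of base objects, given as an isomorphism compatible with the fields, gives
an equality of vector fields. -/
theorem HomVF.eq_of_eqToIso {Y X : Tangentad K} {u v : HomVF Y X} (e : u.base ≅ v.base)
    (h : u.base = v.base) (he : e = eqToIso h)
    (w : u.field ≫ e.hom ▷ bundle X = e.hom ≫ v.field) : u = v := by
  subst he
  exact VectorField.eq_of_eqToHom h w

variable [Strict K]

theorem induced_id {Y X : Tangentad K} (u : HomVF Y X) : (induced u Y).obj (𝟙 Y) = u :=
  HomVF.eq_of_eqToIso (λ_ u.base) (Strict.id_comp _) (Strict.leftUnitor_eqToIso _) (by simp)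

theorem pushforward_id {Y X : Tangentad K} (u : HomVF Y X) : (pushforward Y (𝟙 X)).obj u = u := by
  refine HomVF.eq_of_eqToIso (ρ_ u.base) (Strict.comp_id _) (Strict.rightUnitor_eqToIso _) ?_
  -- Exhibits the distributive law of the identity as a composite of unitors, which coherence then
  -- cancels.
  have h : distHom (𝟙 X) = (ρ_ (bundle X)).hom ≫ (λ_ (bundle X)).inv := rfl
  simp [h]

theorem induced_comp {W Z Y X : Tangentad K} (u : HomVF Y X) (H : W ⟶ Z) (H' : Z ⟶ Y) :
    (induced u W).obj (H ≫ H') = (induced ((induced u Z).obj H') W).obj H :=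
  HomVF.eq_of_eqToIso (α_ H H' u.base) (Strict.assoc _ _ _) (Strict.associator_eqToIso _ _ _)
    (by simp)

/-- Both fields are $\alpha_G \circ Fu$ restricted along $H$: restricting commutes with pushing
forward, by associativity of whiskering. -/
theorem induced_pushforward {Z Y X X' : Tangentad K} (u : HomVF Y X) (H : Z ⟶ Y) (F : X ⟶ X') :
    (pushforward Z F).obj ((induced u Z).obj H) = (induced ((pushforward Y F).obj u) Z).obj H :=
  HomVF.eq_of_eqToIso (α_ H u.base F) (Strict.assoc _ _ _) (Strict.associator_eqToIso _ _ _)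
    (by simp)

theorem distHom_comp {X Y Z : Tangentad K} (F : X ⟶ Y) (G : Y ⟶ Z) :
    distHom (F ≫ G) = (α_ (bundle X) F G).inv ≫ distHom F ▷ G ≫ (α_ F (bundle Y) G).hom ≫
      F ◁ distHom G ≫ (α_ F G (bundle Z)).inv := rfl

theorem pushforward_comp {Z X Y W : Tangentad K} (u : HomVF Z X) (F : X ⟶ Y) (G : Y ⟶ W) :
    (pushforward Z G).obj ((pushforward Z F).obj u) = (pushforward Z (F ≫ G)).obj u :=
  HomVF.eq_of_eqToIso (α_ u.base F G) (Strict.assoc _ _ _) (Strict.associator_eqToIso _ _ _)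
    (by dsimp only; rw [distHom_comp]; simp)

end Strict

/-! ### Construction of the 2-functor from the universal property -/

section Universal

variable {K : Type u} [Bicategory.{w, v} K]

namespace UniversalVectorField

variable {V X : Tangentad K} (U : UniversalVectorField V X) (Y : Tangentad K)

theorem isEquivalence_induced : (induced U.v Y).IsEquivalence := by
  obtain ⟨inv, h₁, h₂⟩ := U.universal Y
  exact (CategoryTheory.Equivalence.mk (induced U.v Y) inv (eqToIso h₁.symm)
    (eqToIso h₂)).isEquivalence_functor

instance : (induced U.v Y).Full := (U.isEquivalence_induced Y).full

instance : (induced U.v Y).Faithful := (U.isEquivalence_induced Y).faithful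

/-- An equivalence would give this only up to isomorphism; the strict inverse is what allows
functoriality on 1-morphisms to hold as an equality. -/
theorem induced_obj_injective : Function.Injective (induced U.v Y).obj := by
  obtain ⟨inv, h, -⟩ := U.universal Y
  exact Function.LeftInverse.injective (g := inv.obj) (fun H => Functor.congr_obj h H)

theorem induced_obj_surjective : Function.Surjective (induced U.v Y).obj := by
  obtain ⟨inv, -, h⟩ := U.universal Y
  exact Function.RightInverse.surjective (g := inv.obj) (fun u => Functor.congr_obj h u)

end UniversalVectorField

variable {obj : Tangentad K → Tangentad K} (U : ∀ X, UniversalVectorField (obj X) X)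

/-- The action of the 2-functor of vector fields on 1-morphisms. -/
noncomputable def vfMap {X Y : Tangentad K} (F : X ⟶ Y) : obj X ⟶ obj Y :=
  ((U Y).induced_obj_surjective (obj X) ((pushforward (obj X) F).obj (U X).v)).choose

theorem induced_vfMap {X Y : Tangentad K} (F : X ⟶ Y) :
    (induced (U Y).v (obj X)).obj (vfMap U F) = (pushforward (obj X) F).obj (U X).v :=
  ((U Y).induced_obj_surjective (obj X) ((pushforward (obj X) F).obj (U X).v)).choose_spec

theorem vfMap_comp_base {X Y : Tangentad K} (F : X ⟶ Y) :
    vfMap U F ≫ (U Y).v.base = (U X).v.base ≫ F :=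
  congrArg VectorField.base (induced_vfMap U F)

/-- The action of the 2-functor of vector fields on 2-morphisms. -/
noncomputable def vfMap₂ {X Y : Tangentad K} {F G : X ⟶ Y} (φ : F ⟶ G) : vfMap U F ⟶ vfMap U G :=
  (induced (U Y).v (obj X)).preimage
    (eqToHom (induced_vfMap U F) ≫ (pushforward₂ (obj X) φ).app (U X).v ≫
      eqToHom (induced_vfMap U G).symm)

theorem induced_vfMap₂ {X Y : Tangentad K} {F G : X ⟶ Y} (φ : F ⟶ G) :
    (induced (U Y).v (obj X)).map (vfMap₂ U φ) =
      eqToHom (induced_vfMap U F) ≫ (pushforward₂ (obj X) φ).app (U X).v ≫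
        eqToHom (induced_vfMap U G).symm :=
  Functor.map_preimage _ _

/-- The underlying 2-morphism of `induced_vfMap₂`; with faithfulness of $\Gamma$ it reduces every
law on 2-morphisms to one about whiskerings of $\varphi$. -/
theorem vfMap₂_whiskerRight_base {X Y : Tangentad K} {F G : X ⟶ Y} (φ : F ⟶ G) :
    vfMap₂ U φ ▷ (U Y).v.base = eqToHom (vfMap_comp_base U F) ≫ (U X).v.base ◁ φ ≫
      eqToHom (vfMap_comp_base U G).symm := by
  have h := congrArg VectorField.Hom.hom (induced_vfMap₂ U φ)
  simpa only [VectorField.comp_hom, VectorField.eqToHom_hom] using h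

theorem UniversalVectorField.whiskerRight_base_injective {V X Y : Tangentad K}
    (U : UniversalVectorField V X) {H H' : Y ⟶ V} {φ ψ : H ⟶ H'}
    (h : φ ▷ U.v.base = ψ ▷ U.v.base) : φ = ψ :=
  (induced U.v Y).map_injective (VectorField.hom_ext h)

variable [Strict K]

theorem vfMap_id (X : Tangentad K) : vfMap U (𝟙 X) = 𝟙 (obj X) := by
  apply (U X).induced_obj_injective
  rw [induced_vfMap, pushforward_id, induced_id]

theorem vfMap_comp {X Y Z : Tangentad K} (F : X ⟶ Y) (G : Y ⟶ Z) :
    vfMap U (F ≫ G) = vfMap U F ≫ vfMap U G := by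
  apply (U Z).induced_obj_injective
  -- With $\hat v_X$ universal for $X$: $\Gamma_{\hat v_Z}(\mathsf{VF}(G) \circ \mathsf{VF}(F)) =
  -- \Gamma_{G_*\hat v_Y}(\mathsf{VF}(F)) = G_*\Gamma_{\hat v_Y}(\mathsf{VF}(F)) = G_*F_*\hat v_X$.
  rw [induced_comp, induced_vfMap, induced_vfMap, ← induced_pushforward, induced_vfMap,
    pushforward_comp]

-- Turns every coherence isomorphism into an `eqToHom`, so that all the bookkeeping factors merge or
-- cancel.
attribute [local simp] Strict.leftUnitor_eqToIso Strict.rightUnitor_eqToIso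
  Strict.associator_eqToIso

/-- The 2-functor of vector fields, for a choice of universal vector fields. -/
noncomputable def vfPreCore : StrictPseudofunctorPreCore (Tangentad K) (Tangentad K) where
  obj := obj
  map F := vfMap U F
  map₂ φ := vfMap₂ U φ
  map₂_id F := by
    apply (U _).whiskerRight_base_injective
    simp [vfMap₂_whiskerRight_base]
  map₂_comp φ ψ := by
    apply (U _).whiskerRight_base_injective
    simp [vfMap₂_whiskerRight_base]
  map_id := vfMap_id U
  map_comp := vfMap_comp U
  map₂_whisker_left {X Y Z} F {G G'} φ := by
    apply (U _).whiskerRight_base_injective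
    simp only [vfMap₂_whiskerRight_base, comp_whiskerRight, whisker_assoc]
    -- Replacing `vfMap U F ≫ (U Y).v.base` by `(U X).v.base ≫ F` brings both sides to `(U X).v.base
    -- ◁ F ◁ φ`, up to `eqToHom`s.
    rw [whiskerLeft_comp, whiskerLeft_comp, comp_whiskerLeft_symm (vfMap U F),
      whiskerLeft_congr (vfMap_comp_base U F)]
    simp
  map₂_whisker_right {X Y Z} F F' φ G := by
    apply (U _).whiskerRight_base_injective
    simp only [vfMap₂_whiskerRight_base, comp_whiskerRight, whiskerRight_comp_symm]
    -- Moving the base past `G` lets it meet `vfMap₂ U φ`, whose whiskering with the base is known;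
    -- both sides become `(U X).v.base ◁ φ ▷ G`.
    rw [whiskerRight_congr _ (vfMap_comp_base U G)]
    simp [vfMap₂_whiskerRight_base]

end Universal

end Tangentads

open Tangentads
theorem mainTheorem3 {K : Type u} [Bicategory.{w, v} K] [Bicategory.Strict K]
    (hK : AdmitsVectorFields K) :
    Nonempty (∀ X : Tangentad K, Σ V : Tangentad K, UniversalVectorField V X) ∧
    ∀ (obj : Tangentad K → Tangentad K) (U : ∀ X, UniversalVectorField (obj X) X),
      ∃ (VF : StrictPseudofunctor (Tangentad K) (Tangentad K)) (h : obj = VF.obj),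
        ActsByUniversalProperty VF (h ▸ U) :=
  ⟨⟨fun X => ⟨(hK X).choose, (hK X).choose_spec.some⟩⟩, fun _ U =>
    -- The object map is the given one by definition, so the transport `h ▸ U` is trivial.
    ⟨StrictPseudofunctor.mk'' (vfPreCore U), rfl,
      fun F => induced_vfMap U F, fun φ => induced_vfMap₂ U φ⟩⟩
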